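/- Let $n\ge 0$ and consider $2n$ bosonic modes ($\hbar=1$, $a_m=(x_m+ip_m)/\sqrt2$), split equally into $n$ modes $\vec a_A$ and $n$ modes $\vec a_B$, with Hilbert space $L^2(\mathbb R^n)\otimes L^2(\mathbb R^n)=L^2(\mathbb R^n\times\mathbb R^n)$. Let $\rho$ be a density operator on this space, i.e. a positive semidefinite operator of trace one. * Let $\rho^{T_B}$ denote the partial transpose of $\rho$ over the modes $\vec a_B$ in the position (equivalently, Fock) basis, i.e. the bounded operator with $\langle\varphi\otimes\psi,\rho^{T_B}(\varphi'\otimes\psi')\rangle=\langle\varphi\otimes\overline{\psi'},\rho\,(\varphi'\otimes\overline{\psi})\rangle$ for all $\varphi,\varphi',\psi,\psi'\in L^2(\mathbb R^n)$. * Let $\operatorname{tr}_-\rho$ denote the partial trace of $\rho$ over the collective modes $\vec a_-=(\vec a_A-\vec a_B)/\sqrt2$, a state of the $n$ modes $\vec a_+=(\vec a_A+\vec a_B)/\sqrt2$. That is, $\operatorname{tr}_-\rho=\operatorname{tr}_2(U\rho U^\dagger)$, where $(U\psi)(x_+,x_-)=\psi\big(\tfrac{x_++x_-}{\sqrt2},\tfrac{x_+-x_-}{\sqrt2}\big)$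 and $\operatorname{tr}_2$ is the partial trace over the second tensor factor. * For a trace-class operator $O$ on $L^2(\mathbb R^n)$, let $W_O(\vec\alpha)=(2/\pi)^n\operatorname{tr}[O\,D(\vec\alpha)\,\Pi\,D(\vec\alpha)^\dagger]$, $\vec\alpha\in\mathbb C^n$, denote its Wigner function, where $D(\vec\alpha)=\exp\big(\sum_m\alpha_m a_m^\dagger-\alpha_m^*a_m\big)$ is the displacement operator and $(\Pi f)(x)=f(-x)$ is the parity operator. If the Wigner function $W_{\operatorname{tr}_-\rho}$ is not everywhere nonnegative (i.e. it takes a negative value at some $\vec\alpha\in\mathbb C^n$), then $\rho^{T_B}$ is not positive semidefinite. Equivalently, if $\rho^{T_B}\succeq0$, then $W_{\operatorname{tr}_-\rho}(\vec\alpha)\ge0$ for all $\vec\alpha\in\mathbb C^n$. -/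

import Mathlib

open scoped ComplexOrder

noncomputable section

namespace WignerPPT

open MeasureTheory Complex ContinuousLinearMap

/-! Throughout `ħ = 1`, and the modes are realized in the Schrödinger (position) representation,
with annihilation operators `a = (x + i p) / √2`, `p = -i ∂/∂x`. -/

/-- Configuration space `ℝⁿ` of `n` bosonic modes. -/
abbrev Config (n : ℕ) : Type := EuclideanSpace ℝ (Fin n)

/-- The Hilbert space `L²(ℝⁿ; ℂ)` of `n` modes. -/
abbrev ModeSpace (n : ℕ) : Type := Lp ℂ 2 (volume : Measure (Config n))

/-- The Hilbert space `L²(ℝⁿ × ℝⁿ; ℂ)` of `2n` modes split into `n` modes `A` (first factor) and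
`n` modes `B` (second factor). -/
abbrev BipartiteSpace (n : ℕ) : Type :=
  Lp ℂ 2 ((volume : Measure (Config n)).prod (volume : Measure (Config n)))

/-! ### Trace and density operators -/

section Trace

variable (E : Type*) [NormedAddCommGroup E] [InnerProductSpace ℂ E] [CompleteSpace E]

/-- The index set of a fixed orthonormal basis of the Hilbert space `E`. -/
def basisIndex : Set E := (exists_hilbertBasis ℂ E).choose

/-- A fixed orthonormal basis of the Hilbert space `E`. -/
def basis : HilbertBasis (basisIndex E) ℂ E := (exists_hilbertBasis ℂ E).choose_spec.choose

variable {E}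

/-- The trace `∑ᵢ ⟨eᵢ, T eᵢ⟩`. For a trace-class operator the series converges absolutely and its
sum does not depend on the orthonormal basis. -/
def trace (T : E →L[ℂ] E) : ℂ := ∑' i, inner ℂ (basis E i) (T (basis E i))

/-- A density operator (quantum state): a positive operator of trace one. For a positive operator
the value of the series of diagonal elements does not depend on the orthonormal basis. -/
structure IsDensityOperator (ρ : E →L[ℂ] E) : Prop where
  isPositive : ρ.IsPositive
  hasSum_trace : HasSum (fun i => inner ℂ (basis E i) (ρ (basis E i))) 1

end Trace

/-! ### Displacement operators, parity, and the Wigner function -/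

section Wigner

variable {n : ℕ}

theorem memLp_phase_mul {X : Type*} [MeasurableSpace X] {μ : Measure X} {θ : X → ℝ}
    (hθ : Measurable θ) (f : Lp ℂ 2 μ) : MemLp (fun x => exp (θ x * I) * f x) 2 μ := by
  have hm : Measurable fun x => exp (θ x * I) := by fun_prop
  refine (Lp.memLp f).of_le (hm.aestronglyMeasurable.mul (Lp.aestronglyMeasurable f)) ?_
  exact Filter.Eventually.of_forall fun x => by simp [norm_exp_ofReal_mul_I]

/-- Multiplication by the phase `exp (i θ(x))` on `L²`. -/
def phaseMul {X : Type*} [MeasurableSpace X] {μ : Measure X} (θ : X → ℝ) (hθ : Measurable θ) :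
    Lp ℂ 2 μ →ₗᵢ[ℂ] Lp ℂ 2 μ where
  toFun f := (memLp_phase_mul hθ f).toLp _
  map_add' f g := by
    rw [← MemLp.toLp_add]
    refine MemLp.toLp_congr _ _ ?_
    filter_upwards [Lp.coeFn_add f g] with x hx
    simp only [hx, Pi.add_apply, mul_add]
  map_smul' c f := by
    rw [RingHom.id_apply, ← MemLp.toLp_const_smul]
    refine MemLp.toLp_congr _ _ ?_
    filter_upwards [Lp.coeFn_smul c f] with x hx
    simp [hx, mul_left_comm]
  norm_map' f := by
    change ‖(memLp_phase_mul hθ f).toLp _‖ = ‖f‖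
    rw [Lp.norm_toLp, Lp.norm_def]
    congr 1
    exact eLpNorm_congr_norm_ae
      (Filter.Eventually.of_forall fun x => by simp [norm_exp_ofReal_mul_I])

/-- The position `√2 Re α` of the phase-space point `α = (q + i p) / √2`. -/
def pos (α : Fin n → ℂ) : Config n := WithLp.toLp 2 fun m => √2 * (α m).re

/-- The momentum `√2 Im α` of the phase-space point `α = (q + i p) / √2`. -/
def mom (α : Fin n → ℂ) : Config n := WithLp.toLp 2 fun m => √2 * (α m).im

/-- The translation `f ↦ f(· - q)`. -/
def translation (q : Config n) : ModeSpace n →L[ℂ] ModeSpace n :=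
  (Lp.compMeasurePreservingₗᵢ ℂ (fun x : Config n => x - q)
    (measurePreserving_sub_right volume q)).toContinuousLinearMap

/-- The displacement operator `D(α) = exp(∑ₘ αₘ aₘ† - αₘ* aₘ)`; for `α = (q + i p) / √2` it acts on
wave functions as `(D(α) f)(x) = exp(i (p · x - p · q / 2)) f(x - q)`. -/
def displacement (α : Fin n → ℂ) : ModeSpace n →L[ℂ] ModeSpace n :=
  (phaseMul (fun x : Config n => inner ℝ (mom α) x - inner ℝ (mom α) (pos α) / 2)
    (by fun_prop)).toContinuousLinearMap ∘L translation (pos α)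

/-- The parity operator `f ↦ f(-·)`. -/
def parity (n : ℕ) : ModeSpace n →L[ℂ] ModeSpace n :=
  (Lp.compMeasurePreservingₗᵢ ℂ (fun x : Config n => -x)
    (Measure.measurePreserving_neg volume)).toContinuousLinearMap

/-- The Wigner function `W_O(α) = (2/π)ⁿ tr[O D(α) Π D(α)†]` of a trace-class operator `O` on `n`
modes, where `Π` is the parity operator. It is normalized with respect to the measure
`∏ₘ d(Re αₘ) d(Im αₘ)`, and its symplectic Fourier transform is the characteristic function
`ξ ↦ tr[O D(ξ)]`. Its values are real when `O` is self-adjoint. -/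
def wigner (O : ModeSpace n →L[ℂ] ModeSpace n) (α : Fin n → ℂ) : ℂ :=
  ((2 / Real.pi : ℝ) : ℂ) ^ n *
    trace (O ∘L displacement α ∘L parity n ∘L adjoint (displacement α))

end Wigner

/-! ### Tensor products of vectors, partial trace and partial transpose -/

section Bipartite

variable {n : ℕ}

theorem memLp_tensor (φ ψ : ModeSpace n) :
    MemLp (fun z : Config n × Config n => φ z.1 * ψ z.2) 2
      ((volume : Measure (Config n)).prod (volume : Measure (Config n))) := by
  have hm : AEStronglyMeasurable (fun z : Config n × Config n => φ z.1 * ψ z.2)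
      ((volume : Measure (Config n)).prod (volume : Measure (Config n))) :=
    (Lp.aestronglyMeasurable φ).comp_fst.mul (Lp.aestronglyMeasurable ψ).comp_snd
  rw [memLp_two_iff_integrable_sq_norm hm]
  have hφ := (memLp_two_iff_integrable_sq_norm (Lp.aestronglyMeasurable φ)).1 (Lp.memLp φ)
  have hψ := (memLp_two_iff_integrable_sq_norm (Lp.aestronglyMeasurable ψ)).1 (Lp.memLp ψ)
  simpa [mul_pow] using hφ.mul_prod hψ

/-- The product vector `φ ⊗ ψ`, i.e. the wave function `(x, y) ↦ φ(x) ψ(y)`. -/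
def tensor (φ ψ : ModeSpace n) : BipartiteSpace n := (memLp_tensor φ ψ).toLp _

theorem norm_sq_eq_integral {X : Type*} [MeasurableSpace X] {μ : Measure X} (f : Lp ℂ 2 μ) :
    ‖f‖ ^ 2 = ∫ x, ‖f x‖ ^ 2 ∂μ := by
  have h : ((‖f‖ ^ 2 : ℝ) : ℂ) = ((∫ x, ‖f x‖ ^ 2 ∂μ : ℝ) : ℂ) := by
    have := inner_self_eq_norm_sq_to_K (𝕜 := ℂ) f
    rw [L2.inner_def] at this
    rw [← integral_complex_ofReal]
    simpa [inner_self_eq_norm_sq_to_K] using this.symm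
  exact_mod_cast h

theorem norm_tensor (φ ψ : ModeSpace n) : ‖tensor φ ψ‖ = ‖φ‖ * ‖ψ‖ := by
  have key : ‖tensor φ ψ‖ ^ 2 = (‖φ‖ * ‖ψ‖) ^ 2 := by
    rw [mul_pow, norm_sq_eq_integral, norm_sq_eq_integral, norm_sq_eq_integral,
      ← integral_prod_mul]
    refine integral_congr_ae ?_
    filter_upwards [(memLp_tensor φ ψ).coeFn_toLp] with z hz
    simp only [tensor, hz, norm_mul, mul_pow]
  exact (sq_eq_sq₀ (norm_nonneg _) (by positivity)).1 key

/-- The operator `φ ↦ φ ⊗ ψ`. -/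
def tensorRight (ψ : ModeSpace n) : ModeSpace n →L[ℂ] BipartiteSpace n :=
  LinearMap.mkContinuous
    { toFun := fun φ => tensor φ ψ
      map_add' := fun f g => by
        unfold tensor
        rw [← MemLp.toLp_add]
        refine MemLp.toLp_congr _ _ ?_
        filter_upwards [Measure.quasiMeasurePreserving_fst.ae (Lp.coeFn_add f g)] with z hz
        simp only [hz, Pi.add_apply, add_mul]
      map_smul' := fun c f => by
        unfold tensor
        rw [RingHom.id_apply, ← MemLp.toLp_const_smul]
        refine MemLp.toLp_congr _ _ ?_
        filter_upwards [Measure.quasiMeasurePreserving_fst.ae (Lp.coeFn_smul c f)] with z hz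
        simp [hz, mul_assoc] }
    ‖ψ‖ (fun φ => by
      change ‖tensor φ ψ‖ ≤ _
      rw [norm_tensor, mul_comm])

/-- The partial trace over the second tensor factor: `⟨φ, (tr₂ σ) φ'⟩ = ∑ₖ ⟨φ ⊗ eₖ, σ (φ' ⊗ eₖ)⟩`
for an orthonormal basis `eₖ` of the second factor. For trace-class `σ` the series of operators
converges absolutely in norm and its sum does not depend on the basis. -/
def partialTraceSnd (σ : BipartiteSpace n →L[ℂ] BipartiteSpace n) :
    ModeSpace n →L[ℂ] ModeSpace n :=
  ∑' k, adjoint (tensorRight (basis (ModeSpace n) k)) ∘L σ ∘L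
    tensorRight (basis (ModeSpace n) k)

/-- The partial transpose `ρ^{T_B}` over the second tensor factor, transposition being taken with
respect to the position (equivalently, since Hermite functions are real, the Fock) basis:
`⟨φ ⊗ ψ, ρ^{T_B} (φ' ⊗ ψ')⟩ = ⟨φ ⊗ conj ψ', ρ (φ' ⊗ conj ψ)⟩`.
The vectors `conj eⱼ` form again an orthonormal basis, and the `(j, k)` summand is the block of
`ρ^{T_B}` between `conj eₖ` and `conj eⱼ`, equal to the block of `ρ` between `eⱼ` and `eₖ`. For
trace-class `ρ` the series converges unconditionally in operator norm. -/
def partialTransposeB (ρ : BipartiteSpace n →L[ℂ] BipartiteSpace n) :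
    BipartiteSpace n →L[ℂ] BipartiteSpace n :=
  ∑' p : basisIndex (ModeSpace n) × basisIndex (ModeSpace n),
    tensorRight (star (basis (ModeSpace n) p.2)) ∘L
      (adjoint (tensorRight (basis (ModeSpace n) p.1)) ∘L ρ ∘L
        tensorRight (basis (ModeSpace n) p.2)) ∘L
      adjoint (tensorRight (star (basis (ModeSpace n) p.1)))

/-! ### Collective modes -/

/-- The change of coordinates `(u, v) ↦ ((u + v)/√2, (u - v)/√2)` between `(x_+, x_-)` and
`(x_A, x_B)`; it is its own inverse. -/
def collective (n : ℕ) : Config n × Config n →ₗ[ℝ] Config n × Config n :=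
  (√2)⁻¹ • LinearMap.prod (LinearMap.fst ℝ _ _ + LinearMap.snd ℝ _ _)
    (LinearMap.fst ℝ _ _ - LinearMap.snd ℝ _ _)

theorem collective_comp_self (n : ℕ) : collective n ∘ₗ collective n = LinearMap.id := by
  have h : (√2)⁻¹ * (√2)⁻¹ = (2 : ℝ)⁻¹ := by
    rw [← mul_inv, Real.mul_self_sqrt (by norm_num)]
  refine LinearMap.ext fun z => Prod.ext ?_ ?_
  · change (√2)⁻¹ • ((√2)⁻¹ • (z.1 + z.2) + (√2)⁻¹ • (z.1 - z.2)) = z.1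
    rw [← smul_add, smul_smul, h]
    module
  · change (√2)⁻¹ • ((√2)⁻¹ • (z.1 + z.2) - (√2)⁻¹ • (z.1 - z.2)) = z.2
    rw [← smul_sub, smul_smul, h]
    module

theorem measurePreserving_collective (n : ℕ) :
    MeasurePreserving (collective n)
      ((volume : Measure (Config n)).prod (volume : Measure (Config n)))
      ((volume : Measure (Config n)).prod (volume : Measure (Config n))) := by
  have hd : LinearMap.det (collective n) * LinearMap.det (collective n) = 1 := by
    rw [← LinearMap.det_comp, collective_comp_self, LinearMap.det_id]
  have h0 : LinearMap.det (collective n) ≠ 0 := fun h => by simp [h] at hd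
  refine ⟨(collective n).continuous_of_finiteDimensional.measurable, ?_⟩
  rw [Measure.map_linearMap_addHaar_eq_smul_addHaar _ h0]
  rcases mul_self_eq_one_iff.1 hd with h | h <;> simp [h]

/-- The unitary that passes to the tensor decomposition into the collective modes
`a_± = (a_A ± a_B)/√2`: `(U ψ)(x_+, x_-) = ψ((x_+ + x_-)/√2, (x_+ - x_-)/√2)`, so that
`U a_+ U† = a ⊗ 1` and `U a_- U† = 1 ⊗ a`. -/
def collectiveUnitary (n : ℕ) : BipartiteSpace n →L[ℂ] BipartiteSpace n :=
  (Lp.compMeasurePreservingₗᵢ ℂ (collective n)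
    (measurePreserving_collective n)).toContinuousLinearMap

/-- The partial trace `tr_- ρ` over the collective modes `a_- = (a_A - a_B)/√2`, a state of the
modes `a_+ = (a_A + a_B)/√2`. -/
def traceMinus (ρ : BipartiteSpace n →L[ℂ] BipartiteSpace n) : ModeSpace n →L[ℂ] ModeSpace n :=
  partialTraceSnd (collectiveUnitary n ∘L ρ ∘L adjoint (collectiveUnitary n))

end Bipartite

end WignerPPT

end

/-!
Write `Π_α = D(α) Π D(α)†` for the displaced parity, so that `W_O(α)` is a positive multiple of
`tr[O Π_α]`. In position space `Π_α` is a reflection times a phase, and a direct computation gives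
`U† (Π_α ⊗ 1) U = (A ⊗ 1) ∘ SWAP ∘ (A ⊗ 1)` with `A = Π_{α/√2}`. Hence
`tr[(tr_- ρ) Π_α] = tr[(A ⊗ 1) ρ (A ⊗ 1) SWAP]`. Expanded in a product basis `eⱼ ⊗ eₖ`, this is
`∑ⱼₖ ⟨A eⱼ ⊗ eₖ, ρ (A eₖ ⊗ eⱼ)⟩ = ∑ⱼₖ ⟨A eⱼ ⊗ conj eⱼ, ρ^{T_B} (A eₖ ⊗ conj eₖ)⟩`, the formal
expectation of `ρ^{T_B}` in the unnormalizable vector `∑ⱼ A eⱼ ⊗ conj eⱼ`: it is a limit of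
expectations in the finite partial sums, hence nonnegative as soon as `ρ^{T_B}` is positive.
-/

noncomputable section

namespace WignerPPT

open MeasureTheory Complex ContinuousLinearMap

/-! ### Hilbert–Schmidt and trace-class operators -/

section HilbertSchmidt

variable {E F G : Type*} [NormedAddCommGroup E] [InnerProductSpace ℂ E]
  [NormedAddCommGroup F] [InnerProductSpace ℂ F] [NormedAddCommGroup G] [InnerProductSpace ℂ G]
  {ι κ : Type*}

theorem hasSum_norm_inner_sq (b : HilbertBasis ι ℂ E) (x : E) :
    HasSum (fun i => ‖inner ℂ (b i) x‖ ^ 2) (‖x‖ ^ 2) := by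
  simpa [b.repr_apply_apply] using lp.hasSum_norm (p := 2) (by norm_num) (b.repr x)

theorem summable_mul_of_sq {f g : ι → ℝ} (hf : Summable fun i => f i ^ 2)
    (hg : Summable fun i => g i ^ 2) : Summable fun i => f i * g i := by
  refine Summable.of_norm_bounded (hf.add hg) fun i => ?_
  rw [norm_mul, ← sq_abs (f i), ← sq_abs (g i)]
  simp only [Real.norm_eq_abs]
  nlinarith [two_mul_le_add_sq |f i| |g i|, mul_nonneg (abs_nonneg (f i)) (abs_nonneg (g i))]

theorem summable_norm_inner_apply_sq {X : E →L[ℂ] F} (b : HilbertBasis ι ℂ E)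
    (c : HilbertBasis κ ℂ F) (hX : Summable fun i => ‖X (b i)‖ ^ 2) :
    Summable fun p : ι × κ => ‖inner ℂ (c p.2) (X (b p.1))‖ ^ 2 :=
  (summable_prod_of_nonneg fun _ => by positivity).2
    ⟨fun i => (hasSum_norm_inner_sq c (X (b i))).summable, by
      simpa only [(hasSum_norm_inner_sq c _).tsum_eq] using hX⟩

theorem hasSum_inner_tsum_apply {T : ι → E →L[ℂ] F} (hT : Summable T) (x : F) (y : E) :
    HasSum (fun i => inner ℂ x (T i y)) (inner ℂ x ((∑' i, T i) y)) :=
  (innerSL ℂ x ∘L ContinuousLinearMap.apply ℂ F y).hasSum hT.hasSum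

theorem nonneg_of_hasSum_inner_apply {T : E →L[ℂ] E} (hT : T.IsPositive) {v : κ → E} {a : ℂ}
    (h : HasSum (fun p : κ × κ => inner ℂ (v p.1) (T (v p.2))) a) : 0 ≤ a := by
  have squares := h.comp (Filter.tendsto_finsetProd_atTop.comp Filter.tendsto_atTop_diagonal)
  refine ge_of_tendsto' squares fun s => ?_
  simp only [Function.comp_apply, Finset.sum_product, ← inner_sum, ← sum_inner, ← map_sum]
  exact hT.inner_nonneg_right _

variable [CompleteSpace E] [CompleteSpace F] [CompleteSpace G]

theorem summable_norm_adjoint_apply_sq {X : E →L[ℂ] F} (b : HilbertBasis ι ℂ E)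
    (c : HilbertBasis κ ℂ F) (hX : Summable fun i => ‖X (b i)‖ ^ 2) :
    Summable fun j => ‖adjoint X (c j)‖ ^ 2 := by
  refine (summable_norm_inner_apply_sq b c hX).prod_symm.prod.congr fun j => ?_
  rw [← (hasSum_norm_inner_sq b (adjoint X (c j))).tsum_eq]
  refine tsum_congr fun i => ?_
  rw [adjoint_inner_right, norm_inner_symm]
  rfl

theorem norm_sq_le_tsum_norm_apply_sq {X : E →L[ℂ] F} (b : HilbertBasis ι ℂ E)
    (hX : Summable fun i => ‖X (b i)‖ ^ 2) : ‖X‖ ^ 2 ≤ ∑' i, ‖X (b i)‖ ^ 2 := by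
  have h0 : 0 ≤ ∑' i, ‖X (b i)‖ ^ 2 := tsum_nonneg fun i => by positivity
  rw [← LinearIsometryEquiv.norm_map adjoint X, ← Real.le_sqrt (norm_nonneg _) h0]
  refine opNorm_le_bound _ (Real.sqrt_nonneg _) fun y => ?_
  rw [← sq_le_sq₀ (norm_nonneg _) (by positivity)]
  calc ‖adjoint X y‖ ^ 2 = ∑' i, ‖inner ℂ (X (b i)) y‖ ^ 2 := by
        simp only [← (hasSum_norm_inner_sq b (adjoint X y)).tsum_eq, adjoint_inner_right]
    _ ≤ ∑' i, ‖X (b i)‖ ^ 2 * ‖y‖ ^ 2 := by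
        refine Summable.tsum_le_tsum (fun i => ?_) ?_ (hX.mul_right _)
        · rw [← mul_pow]
          gcongr
          exact norm_inner_le_norm _ _
        · simpa only [adjoint_inner_right] using (hasSum_norm_inner_sq b (adjoint X y)).summable
    _ = (√(∑' i, ‖X (b i)‖ ^ 2) * ‖y‖) ^ 2 := by rw [tsum_mul_right, mul_pow, Real.sq_sqrt h0]

/-- Hilbert–Schmidt operators, the operators with `∑ᵢ ‖X eᵢ‖² < ∞`. The condition is stated for the
fixed basis of `E`; by `IsHilbertSchmidt.summable_norm_sq` it then holds for every basis. -/
def IsHilbertSchmidt (X : E →L[ℂ] F) : Prop := Summable fun i => ‖X (basis E i)‖ ^ 2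

namespace IsHilbertSchmidt

variable {X Y : E →L[ℂ] F}

theorem adjoint (hX : IsHilbertSchmidt X) : IsHilbertSchmidt X.adjoint :=
  summable_norm_adjoint_apply_sq _ _ hX

theorem summable_norm_sq (hX : IsHilbertSchmidt X) (b : HilbertBasis ι ℂ E) :
    Summable fun i => ‖X (b i)‖ ^ 2 := by
  simpa only [adjoint_adjoint] using summable_norm_adjoint_apply_sq _ b hX.adjoint

theorem comp (hX : IsHilbertSchmidt X) (V : G →L[ℂ] E) : IsHilbertSchmidt (X ∘L V) := by
  rw [← adjoint_adjoint (X ∘L V)]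
  refine IsHilbertSchmidt.adjoint (Summable.of_nonneg_of_le (fun j => by positivity) (fun j => ?_)
    (hX.adjoint.mul_left (‖V.adjoint‖ ^ 2)))
  rw [adjoint_comp, comp_apply, ← mul_pow]
  gcongr
  exact le_opNorm _ _

theorem summable_inner (hX : IsHilbertSchmidt X) (hY : IsHilbertSchmidt Y)
    (b : HilbertBasis ι ℂ E) : Summable fun i => inner ℂ (X (b i)) (Y (b i)) :=
  .of_norm_bounded
    (summable_mul_of_sq (hX.summable_norm_sq b) (hY.summable_norm_sq b))
    fun _ => norm_inner_le_norm _ _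

theorem summable_inner_mul_inner (hX : IsHilbertSchmidt X) (hY : IsHilbertSchmidt Y)
    (b : HilbertBasis ι ℂ E) (c : HilbertBasis κ ℂ F) :
    Summable fun p : ι × κ => inner ℂ (X (b p.1)) (c p.2) * inner ℂ (c p.2) (Y (b p.1)) := by
  refine .of_norm_bounded (summable_mul_of_sq
    (summable_norm_inner_apply_sq b c (hX.summable_norm_sq b))
    (summable_norm_inner_apply_sq b c (hY.summable_norm_sq b))) fun p => ?_
  rw [norm_mul, norm_inner_symm]

theorem tsum_inner_eq_tsum_inner_adjoint (hX : IsHilbertSchmidt X) (hY : IsHilbertSchmidt Y)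
    (b : HilbertBasis ι ℂ E) (c : HilbertBasis κ ℂ F) :
    ∑' i, inner ℂ (X (b i)) (Y (b i)) = ∑' j, inner ℂ (Y.adjoint (c j)) (X.adjoint (c j)) :=
  calc ∑' i, inner ℂ (X (b i)) (Y (b i))
      = ∑' i, ∑' j, inner ℂ (X (b i)) (c j) * inner ℂ (c j) (Y (b i)) :=
        tsum_congr fun i => (c.tsum_inner_mul_inner _ _).symm
    _ = ∑' j, ∑' i, inner ℂ (X (b i)) (c j) * inner ℂ (c j) (Y (b i)) :=
        (summable_inner_mul_inner hX hY b c).tsum_comm.symm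
    _ = ∑' j, inner ℂ (Y.adjoint (c j)) (X.adjoint (c j)) := tsum_congr fun j => by
        rw [← b.tsum_inner_mul_inner]
        refine tsum_congr fun i => ?_
        rw [adjoint_inner_left, adjoint_inner_right, mul_comm]

theorem hasSum_trace (hX : IsHilbertSchmidt X) (hY : IsHilbertSchmidt Y)
    (b : HilbertBasis ι ℂ E) :
    HasSum (fun i => inner ℂ (X (b i)) (Y (b i))) (trace (X.adjoint ∘L Y)) := by
  convert (summable_inner hX hY b).hasSum using 1
  rw [tsum_inner_eq_tsum_inner_adjoint hX hY b (basis F),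
    ← tsum_inner_eq_tsum_inner_adjoint hX hY (basis E)]
  simp only [trace, comp_apply, adjoint_inner_right]

theorem trace_adjoint_comp_comm (hX : IsHilbertSchmidt X) (hY : IsHilbertSchmidt Y) :
    trace (X.adjoint ∘L Y) = trace (Y ∘L X.adjoint) := by
  have h := (hY.adjoint.hasSum_trace hX.adjoint (basis F)).tsum_eq
  rw [adjoint_adjoint] at h
  rw [← h, ← tsum_inner_eq_tsum_inner_adjoint hX hY (basis E),
    (hX.hasSum_trace hY (basis E)).tsum_eq]

end IsHilbertSchmidt

/-- Trace-class operators, encoded as the products `X† Y` of two Hilbert–Schmidt operators. -/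
def IsTraceClass (T : E →L[ℂ] E) : Prop :=
  ∃ X Y : E →L[ℂ] E, IsHilbertSchmidt X ∧ IsHilbertSchmidt Y ∧ T = adjoint X ∘L Y

theorem isTraceClass_of_isPositive {T : E →L[ℂ] E} (hT : T.IsPositive)
    (hs : Summable fun i => inner ℂ (basis E i) (T (basis E i))) : IsTraceClass T := by
  obtain ⟨S, rfl⟩ := CStarAlgebra.nonneg_iff_eq_star_mul_self.1 ((nonneg_iff_isPositive T).2 hT)
  have hS : IsHilbertSchmidt S := by
    refine Complex.summable_ofReal.1 (hs.congr fun i => ?_)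
    rw [star_eq_adjoint, mul_apply_eq_comp, adjoint_inner_right, inner_self_eq_norm_sq_to_K]
    simp
  exact ⟨S, S, hS, hS, rfl⟩

namespace IsTraceClass

variable {T : E →L[ℂ] E}

theorem comp (hT : IsTraceClass T) (V : E →L[ℂ] E) : IsTraceClass (T ∘L V) := by
  obtain ⟨X, Y, hX, hY, rfl⟩ := hT
  exact ⟨X, Y ∘L V, hX, hY.comp V, rfl⟩

theorem comp_left (hT : IsTraceClass T) (V : E →L[ℂ] E) : IsTraceClass (V ∘L T) := by
  obtain ⟨X, Y, hX, hY, rfl⟩ := hT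
  exact ⟨X ∘L adjoint V, Y, hX.comp _, hY, by rw [adjoint_comp, adjoint_adjoint, comp_assoc]⟩

theorem hasSum_trace (hT : IsTraceClass T) (b : HilbertBasis ι ℂ E) :
    HasSum (fun i => inner ℂ (b i) (T (b i))) (trace T) := by
  obtain ⟨X, Y, hX, hY, rfl⟩ := hT
  simpa only [comp_apply, adjoint_inner_right] using hX.hasSum_trace hY b

theorem trace_comp_comm (hT : IsTraceClass T) (V : E →L[ℂ] E) :
    trace (T ∘L V) = trace (V ∘L T) := by
  obtain ⟨X, Y, hX, hY, rfl⟩ := hT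
  calc trace (adjoint X ∘L (Y ∘L V)) = trace (Y ∘L (V ∘L adjoint X)) :=
        hX.trace_adjoint_comp_comm (hY.comp V)
    _ = trace (Y ∘L adjoint (X ∘L adjoint V)) := by rw [adjoint_comp, adjoint_adjoint]
    _ = trace (adjoint (X ∘L adjoint V) ∘L Y) :=
        ((hX.comp _).trace_adjoint_comp_comm hY).symm
    _ = trace (V ∘L adjoint X ∘L Y) := by rw [adjoint_comp, adjoint_adjoint, comp_assoc]

end IsTraceClass

theorem adjoint_eq_of_apply_apply {V : E →L[ℂ] F} (hV : ∀ x, ‖V x‖ = ‖x‖) {W : F →L[ℂ] E}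
    (h : ∀ y, V (W y) = y) : adjoint V = W := by
  ext1 y
  conv_lhs => rw [← h y]
  exact DFunLike.congr_fun ((norm_map_iff_adjoint_comp_self V).1 hV) (W y)

end HilbertSchmidt

/-! ### Operator matrices along an orthogonal family of isometries -/

section OperatorMatrix

variable {E F : Type*} [NormedAddCommGroup E] [InnerProductSpace ℂ E] [CompleteSpace E]
  [NormedAddCommGroup F] [InnerProductSpace ℂ F] [CompleteSpace F] {κ : Type*}
  {V : κ → E →ₗᵢ[ℂ] F}

theorem sum_norm_adjoint_apply_sq_le (hV : OrthogonalFamily ℂ (fun _ => E) V) (s : Finset κ)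
    (ξ : F) : ∑ j ∈ s, ‖adjoint (V j).toContinuousLinearMap ξ‖ ^ 2 ≤ ‖ξ‖ ^ 2 := by
  set c := fun j => adjoint (V j).toContinuousLinearMap ξ
  set y := ∑ j ∈ s, V j (c j)
  have norm_y : ‖y‖ ^ 2 = ∑ j ∈ s, ‖c j‖ ^ 2 := hV.norm_sum c s
  have inner_y : inner ℂ y ξ = ((‖y‖ ^ 2 : ℝ) : ℂ) := by
    rw [norm_y, sum_inner, ofReal_sum]
    refine Finset.sum_congr rfl fun j _ => ?_
    rw [← LinearIsometry.coe_toContinuousLinearMap, ← adjoint_inner_right,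
      inner_self_eq_norm_sq_to_K]
    simp
  have y_le : ‖y‖ * ‖y‖ ≤ ‖y‖ * ‖ξ‖ := by
    have := norm_inner_le_norm (𝕜 := ℂ) y ξ
    rwa [inner_y, norm_real, norm_pow, norm_norm, sq] at this
  rw [← norm_y]
  rcases (norm_nonneg y).eq_or_lt with h | h
  · simpa only [← h, zero_pow two_ne_zero] using sq_nonneg ‖ξ‖
  · exact pow_le_pow_left₀ h.le (le_of_mul_le_mul_left y_le h) 2

theorem sum_norm_adjoint_apply_mul_sq_le (hV : OrthogonalFamily ℂ (fun _ => E) V)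
    (t : Finset (κ × κ)) (ξ η : F) :
    ∑ p ∈ t, (‖adjoint (V p.1).toContinuousLinearMap ξ‖ *
      ‖adjoint (V p.2).toContinuousLinearMap η‖) ^ 2 ≤ ‖ξ‖ ^ 2 * ‖η‖ ^ 2 := by
  classical
  simp only [mul_pow]
  refine (Finset.sum_le_sum_of_subset_of_nonneg (Finset.subset_product (s := t))
    fun p _ _ => by positivity).trans ?_
  simp only [Finset.sum_product, ← Finset.sum_mul_sum]
  exact mul_le_mul (sum_norm_adjoint_apply_sq_le hV _ ξ) (sum_norm_adjoint_apply_sq_le hV _ η)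
    (Finset.sum_nonneg fun _ _ => by positivity) (by positivity)

theorem norm_sum_comp_adjoint_le (hV : OrthogonalFamily ℂ (fun _ => E) V)
    (R : κ × κ → E →L[ℂ] E) (t : Finset (κ × κ)) :
    ‖∑ p ∈ t, (V p.2).toContinuousLinearMap ∘L R p ∘L
      adjoint (V p.1).toContinuousLinearMap‖ ≤ √(∑ p ∈ t, ‖R p‖ ^ 2) := by
  refine opNorm_le_of_re_inner_le (Real.sqrt_nonneg _) fun ξ η hξ hη => ?_
  refine (Complex.re_le_norm _).trans ?_
  rw [sum_apply, sum_inner]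
  calc _ ≤ ∑ p ∈ t, ‖R p‖ * (‖adjoint (V p.1).toContinuousLinearMap ξ‖ *
        ‖adjoint (V p.2).toContinuousLinearMap η‖) := norm_sum_le_of_le _ fun p _ => by
        rw [comp_apply, comp_apply, ← adjoint_inner_right, ← mul_assoc]
        exact (norm_inner_le_norm _ _).trans
          (mul_le_mul_of_nonneg_right (le_opNorm _ _) (norm_nonneg _))
    _ ≤ √(∑ p ∈ t, ‖R p‖ ^ 2) * √(‖ξ‖ ^ 2 * ‖η‖ ^ 2) :=
        (Real.sum_mul_le_sqrt_mul_sqrt _ _ _).trans <| mul_le_mul_of_nonneg_left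
          (Real.sqrt_le_sqrt (sum_norm_adjoint_apply_mul_sq_le hV t ξ η)) (Real.sqrt_nonneg _)
    _ = √(∑ p ∈ t, ‖R p‖ ^ 2) := by simp [hξ, hη]

theorem summable_comp_adjoint (hV : OrthogonalFamily ℂ (fun _ => E) V) {R : κ × κ → E →L[ℂ] E}
    (hR : Summable fun p => ‖R p‖ ^ 2) :
    Summable fun p : κ × κ => (V p.2).toContinuousLinearMap ∘L R p ∘L
      adjoint (V p.1).toContinuousLinearMap := by
  rw [summable_iff_vanishing_norm] at *
  intro ε hε
  obtain ⟨s, hs⟩ := hR (ε ^ 2) (by positivity)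
  refine ⟨s, fun t ht => (norm_sum_comp_adjoint_le hV R t).trans_lt ?_⟩
  exact (Real.sqrt_lt' hε).2 ((le_abs_self _).trans_lt (hs t ht))

end OperatorMatrix

/-! ### Product vectors -/

section Tensor

variable {n : ℕ} {ι κ : Type*}

theorem coeFn_tensor (φ ψ : ModeSpace n) :
    tensor φ ψ =ᵐ[(volume : Measure (Config n)).prod volume] fun z => φ z.1 * ψ z.2 :=
  (memLp_tensor φ ψ).coeFn_toLp

theorem inner_tensor (φ ψ φ' ψ' : ModeSpace n) :
    inner ℂ (tensor φ ψ) (tensor φ' ψ') = inner ℂ φ φ' * inner ℂ ψ ψ' := by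
  rw [L2.inner_def, L2.inner_def, L2.inner_def, ← integral_prod_mul]
  refine integral_congr_ae ?_
  filter_upwards [coeFn_tensor φ ψ, coeFn_tensor φ' ψ'] with z h h'
  rw [h, h']
  simp only [RCLike.inner_apply, map_mul]
  ring

theorem orthonormal_tensor {b : ι → ModeSpace n} {c : κ → ModeSpace n} (hb : Orthonormal ℂ b)
    (hc : Orthonormal ℂ c) : Orthonormal ℂ fun p : ι × κ => tensor (b p.1) (c p.2) := by
  classical
  rw [orthonormal_iff_ite] at *
  intro p p'
  rw [inner_tensor, hb, hc, ite_zero_mul_ite_zero, mul_one]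
  simp only [Prod.ext_iff]

theorem tensorRight_apply (φ ψ : ModeSpace n) : tensorRight ψ φ = tensor φ ψ := rfl

theorem adjoint_tensorRight_tensor (ψ φ' ψ' : ModeSpace n) :
    adjoint (tensorRight ψ) (tensor φ' ψ') = inner ℂ ψ ψ' • φ' := by
  refine ext_inner_left ℂ fun φ => ?_
  rw [adjoint_inner_right, tensorRight_apply, inner_tensor, inner_smul_right, mul_comm]

/-- The isometry `φ ↦ φ ⊗ ψ` for a unit vector `ψ`. -/
def tensorRightₗᵢ (ψ : ModeSpace n) (hψ : ‖ψ‖ = 1) : ModeSpace n →ₗᵢ[ℂ] BipartiteSpace n where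
  toLinearMap := (tensorRight ψ).toLinearMap
  norm_map' φ := by
    change ‖tensor φ ψ‖ = ‖φ‖
    rw [norm_tensor, hψ, mul_one]

theorem orthogonalFamily_tensorRightₗᵢ {f : κ → ModeSpace n} (hf : Orthonormal ℂ f) :
    OrthogonalFamily ℂ (fun _ => ModeSpace n) fun j => tensorRightₗᵢ (f j) (hf.1 j) := by
  intro j k hjk φ φ'
  change inner ℂ (tensor φ (f j)) (tensor φ' (f k)) = 0
  rw [inner_tensor, hf.2 hjk, mul_zero]

/-- The operator `ψ ↦ φ ⊗ ψ`. -/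
def tensorLeft (φ : ModeSpace n) : ModeSpace n →L[ℂ] BipartiteSpace n :=
  LinearMap.mkContinuous
    { toFun := tensor φ
      map_add' := fun ψ ψ' => by
        unfold tensor
        rw [← MemLp.toLp_add]
        refine MemLp.toLp_congr _ _ ?_
        filter_upwards [Measure.quasiMeasurePreserving_snd.ae (Lp.coeFn_add ψ ψ')] with z hz
        simp only [hz, Pi.add_apply, mul_add]
      map_smul' := fun c ψ => by
        unfold tensor
        rw [RingHom.id_apply, ← MemLp.toLp_const_smul]
        refine MemLp.toLp_congr _ _ ?_
        filter_upwards [Measure.quasiMeasurePreserving_snd.ae (Lp.coeFn_smul c ψ)] with z hz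
        simp only [hz, Pi.smul_apply, smul_eq_mul, mul_left_comm] }
    ‖φ‖ fun ψ => (norm_tensor φ ψ).le

theorem tensorLeft_apply (φ ψ : ModeSpace n) : tensorLeft φ ψ = tensor φ ψ := rfl

theorem ae_eq_zero_of_forall_setIntegral_prod_eq_zero {X Y : Type*} [MeasurableSpace X]
    [MeasurableSpace Y] {μ : Measure X} {ν : Measure Y} {f : X × Y → ℂ}
    (hf : Integrable f (μ.prod ν))
    (h : ∀ s t, MeasurableSet s → MeasurableSet t → ∫ z in s ×ˢ t, f z ∂μ.prod ν = 0) :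
    f =ᵐ[μ.prod ν] 0 := by
  refine hf.ae_eq_of_withDensityᵥ_eq (integrable_zero _ _ _) ?_
  have rect : ∀ S ∈ Set.image2 (· ×ˢ ·) {s : Set X | MeasurableSet s} {t : Set Y | MeasurableSet t},
      (μ.prod ν).withDensityᵥ f S = (μ.prod ν).withDensityᵥ 0 S := by
    rintro _ ⟨s, hs, t, ht, rfl⟩
    rw [withDensityᵥ_apply hf (hs.prod ht), h s t hs ht, withDensityᵥ_zero]
    rfl
  exact VectorMeasure.ext_of_generateFrom _ rect generateFrom_prod.symm isPiSystem_prod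
    (rect _ ⟨_, .univ, _, .univ, Set.univ_prod_univ⟩)

theorem exists_memLp_two_forall_ne_zero {X : Type*} [MeasurableSpace X] (μ : Measure X)
    [SigmaFinite μ] : ∃ g : X → ℂ, MemLp g 2 μ ∧ ∀ x, g x ≠ 0 := by
  obtain ⟨w, w_pos, hw, hw_lt⟩ := exists_pos_lintegral_lt_of_sigmaFinite μ one_ne_zero
  refine ⟨fun x => ((√(w x) : ℝ) : ℂ), ?_, fun x => ?_⟩
  · rw [memLp_two_iff_integrable_sq_norm (by fun_prop)]
    refine (integrable_toReal_of_lintegral_ne_top hw.coe_nnreal_ennreal.aemeasurable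
      (hw_lt.trans ENNReal.one_lt_top).ne).congr (.of_forall fun x => ?_)
    simp
  · exact ofReal_ne_zero.2 (Real.sqrt_pos.2 (w_pos x)).ne'

theorem eq_zero_of_forall_inner_tensor_eq_zero {f : BipartiteSpace n}
    (h : ∀ φ ψ, inner ℂ (tensor φ ψ) f = 0) : f = 0 := by
  obtain ⟨g, hg, g_ne⟩ := exists_memLp_two_forall_ne_zero (volume : Measure (Config n))
  set G := hg.toLp g
  have key := ae_eq_zero_of_forall_setIntegral_prod_eq_zero
    (L2.integrable_inner (𝕜 := ℂ) (tensor G G) f) fun s t hs ht => by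
      rw [← h ((hg.indicator hs).toLp _) ((hg.indicator ht).toLp _), L2.inner_def,
        ← integral_indicator (hs.prod ht)]
      refine integral_congr_ae ?_
      filter_upwards [coeFn_tensor G G, coeFn_tensor ((hg.indicator hs).toLp _)
          ((hg.indicator ht).toLp _),
        Measure.quasiMeasurePreserving_fst.ae hg.coeFn_toLp,
        Measure.quasiMeasurePreserving_snd.ae hg.coeFn_toLp,
        Measure.quasiMeasurePreserving_fst.ae (hg.indicator hs).coeFn_toLp,
        Measure.quasiMeasurePreserving_snd.ae (hg.indicator ht).coeFn_toLp] with z h1 h2 h3 h4 h5 h6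
      rw [h2, h5, h6]
      by_cases hz1 : z.1 ∈ s <;> by_cases hz2 : z.2 ∈ t <;>
        simp [Set.indicator, Set.mem_prod, hz1, hz2, h1, h3, h4, G]
  refine (Lp.eq_zero_iff_ae_eq_zero).2 ?_
  filter_upwards [key, coeFn_tensor G G, Measure.quasiMeasurePreserving_fst.ae hg.coeFn_toLp,
    Measure.quasiMeasurePreserving_snd.ae hg.coeFn_toLp] with z h1 h2 h3 h4
  rw [h2, h3, h4] at h1
  simpa [g_ne] using h1

theorem eq_zero_of_forall_inner_basis {E : Type*} [NormedAddCommGroup E] [InnerProductSpace ℂ E]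
    (b : HilbertBasis ι ℂ E) {x : E} (h : ∀ i, inner ℂ (b i) x = 0) : x = 0 := by
  rw [← inner_self_eq_zero (𝕜 := ℂ), ← b.tsum_inner_mul_inner]
  simp [h]

/-- The orthonormal basis `bᵢ ⊗ cⱼ` of the bipartite space. -/
def tensorBasis (b : HilbertBasis ι ℂ (ModeSpace n)) (c : HilbertBasis κ ℂ (ModeSpace n)) :
    HilbertBasis (ι × κ) ℂ (BipartiteSpace n) :=
  HilbertBasis.mkOfOrthogonalEqBot (orthonormal_tensor b.orthonormal c.orthonormal) <| by
    rw [Submodule.eq_bot_iff]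
    intro f hf
    have hbc : ∀ i j, inner ℂ (tensor (b i) (c j)) f = 0 := fun i j =>
      (Submodule.mem_orthogonal _ _).1 hf _ (Submodule.subset_span ⟨(i, j), rfl⟩)
    have hb : ∀ i, adjoint (tensorLeft (b i)) f = 0 := fun i =>
      eq_zero_of_forall_inner_basis c fun j => by
        rw [adjoint_inner_right, tensorLeft_apply, hbc]
    have hψ : ∀ ψ, adjoint (tensorRight ψ) f = 0 := fun ψ =>
      eq_zero_of_forall_inner_basis b fun i => by
        rw [adjoint_inner_right, tensorRight_apply, ← tensorLeft_apply, ← adjoint_inner_right, hb,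
          inner_zero_right]
    refine eq_zero_of_forall_inner_tensor_eq_zero fun φ ψ => ?_
    rw [← tensorRight_apply, ← adjoint_inner_right, hψ, inner_zero_right]

theorem tensorBasis_apply (b : HilbertBasis ι ℂ (ModeSpace n)) (c : HilbertBasis κ ℂ (ModeSpace n))
    (p : ι × κ) : tensorBasis b c p = tensor (b p.1) (c p.2) := by
  rw [tensorBasis, HilbertBasis.coe_mkOfOrthogonalEqBot]

theorem inner_star_star (f g : ModeSpace n) : inner ℂ (star f) (star g) = inner ℂ g f := by
  rw [L2.inner_def, L2.inner_def]
  refine integral_congr_ae ?_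
  filter_upwards [Lp.coeFn_star f, Lp.coeFn_star g] with x hf hg
  rw [hf, hg]
  simp [mul_comm]

theorem orthonormal_star {b : ι → ModeSpace n} (hb : Orthonormal ℂ b) :
    Orthonormal ℂ fun i => star (b i) := by
  classical
  rw [orthonormal_iff_ite] at *
  intro i j
  simp only [inner_star_star, hb, eq_comm]

end Tensor

/-! ### Matrix elements of the partial trace and the partial transpose -/

section Partial

variable {n : ℕ} {κ : Type*} {S X Y : BipartiteSpace n →L[ℂ] BipartiteSpace n}

theorem IsHilbertSchmidt.summable_norm_comp_tensorRight_sq (hX : IsHilbertSchmidt X)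
    (e : HilbertBasis κ ℂ (ModeSpace n)) : Summable fun k => ‖X ∘L tensorRight (e k)‖ ^ 2 := by
  have h : Summable fun p : κ × κ => ‖(X ∘L tensorRight (e p.1)) (e p.2)‖ ^ 2 := by
    simpa only [tensorBasis_apply, comp_apply, tensorRight_apply, Prod.fst_swap, Prod.snd_swap]
      using (hX.summable_norm_sq (tensorBasis e e)).prod_symm
  exact .of_nonneg_of_le (fun k => by positivity)
    (fun k => norm_sq_le_tsum_norm_apply_sq e (h.prod_factor k)) h.prod

theorem norm_adjoint_tensorRight_comp_le (ψ ψ' : ModeSpace n) :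
    ‖adjoint (tensorRight ψ) ∘L (adjoint X ∘L Y) ∘L tensorRight ψ'‖ ≤
      ‖X ∘L tensorRight ψ‖ * ‖Y ∘L tensorRight ψ'‖ :=
  calc _ = ‖adjoint (X ∘L tensorRight ψ) ∘L (Y ∘L tensorRight ψ')‖ := by rw [adjoint_comp]; rfl
    _ ≤ ‖adjoint (X ∘L tensorRight ψ)‖ * ‖Y ∘L tensorRight ψ'‖ := opNorm_comp_le _ _
    _ = _ := by rw [LinearIsometryEquiv.norm_map]

theorem IsTraceClass.hasSum_inner_partialTraceSnd (hS : IsTraceClass S) (φ φ' : ModeSpace n) :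
    HasSum (fun k => inner ℂ (tensor φ (basis (ModeSpace n) k))
      (S (tensor φ' (basis (ModeSpace n) k)))) (inner ℂ φ (partialTraceSnd S φ')) := by
  obtain ⟨X, Y, hX, hY, rfl⟩ := hS
  have hs := Summable.of_norm_bounded
    (summable_mul_of_sq (hX.summable_norm_comp_tensorRight_sq (basis (ModeSpace n)))
      (hY.summable_norm_comp_tensorRight_sq (basis (ModeSpace n))))
    fun k => norm_adjoint_tensorRight_comp_le _ _
  refine (hasSum_inner_tsum_apply hs φ φ').congr_fun fun k => ?_
  simp only [comp_apply, adjoint_inner_right, tensorRight_apply]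

theorem IsTraceClass.trace_partialTraceSnd_comp (hS : IsTraceClass S)
    {R : ModeSpace n →L[ℂ] ModeSpace n} {R₁ : BipartiteSpace n →L[ℂ] BipartiteSpace n}
    (hR : ∀ φ ψ, R₁ (tensor φ ψ) = tensor (R φ) ψ) :
    trace (partialTraceSnd S ∘L R) = trace (S ∘L R₁) := by
  set e := basis (ModeSpace n)
  have total : HasSum (fun p : basisIndex (ModeSpace n) × basisIndex (ModeSpace n) =>
      inner ℂ (tensor (e p.1) (e p.2)) (S (tensor (R (e p.1)) (e p.2)))) (trace (S ∘L R₁)) := by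
    simpa only [tensorBasis_apply, comp_apply, hR] using
      (hS.comp R₁).hasSum_trace (tensorBasis e e)
  exact (total.prod_fiberwise fun i => hS.hasSum_inner_partialTraceSnd (e i) (R (e i))).tsum_eq

theorem IsTraceClass.summable_partialTransposeB (hS : IsTraceClass S) :
    Summable fun p : basisIndex (ModeSpace n) × basisIndex (ModeSpace n) =>
      tensorRight (star (basis (ModeSpace n) p.2)) ∘L
        (adjoint (tensorRight (basis (ModeSpace n) p.1)) ∘L S ∘L
          tensorRight (basis (ModeSpace n) p.2)) ∘L
        adjoint (tensorRight (star (basis (ModeSpace n) p.1))) := by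
  obtain ⟨X, Y, hX, hY, rfl⟩ := hS
  refine summable_comp_adjoint
    (orthogonalFamily_tensorRightₗᵢ (orthonormal_star (basis (ModeSpace n)).orthonormal)) ?_
  refine .of_nonneg_of_le (fun p => by positivity) (fun p => ?_)
    ((hX.summable_norm_comp_tensorRight_sq (basis (ModeSpace n))).mul_of_nonneg
      (hY.summable_norm_comp_tensorRight_sq (basis (ModeSpace n)))
      (fun _ => by positivity) fun _ => by positivity)
  rw [← mul_pow]
  exact pow_le_pow_left₀ (norm_nonneg _) (norm_adjoint_tensorRight_comp_le _ _) 2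

theorem IsTraceClass.hasSum_inner_tensor_partialTransposeB (hS : IsTraceClass S)
    (φ ψ φ' ψ' : ModeSpace n) :
    HasSum (fun p : basisIndex (ModeSpace n) × basisIndex (ModeSpace n) =>
      inner ℂ (star ψ') (basis (ModeSpace n) p.1) *
        (inner ℂ (tensor φ (basis (ModeSpace n) p.1)) (S (tensor φ' (basis (ModeSpace n) p.2))) *
          inner ℂ (basis (ModeSpace n) p.2) (star ψ)))
      (inner ℂ (tensor φ ψ) (partialTransposeB S (tensor φ' ψ'))) := by
  refine (hasSum_inner_tsum_apply hS.summable_partialTransposeB (tensor φ ψ)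
    (tensor φ' ψ')).congr_fun fun p => ?_
  rw [comp_apply, comp_apply, adjoint_tensorRight_tensor, map_smul, map_smul, inner_smul_right,
    tensorRight_apply, inner_tensor, comp_apply, comp_apply, tensorRight_apply,
    adjoint_inner_right, tensorRight_apply, ← inner_star_star,
    star_star, ← inner_star_star (star ψ), star_star]

theorem IsTraceClass.inner_tensor_partialTransposeB (hS : IsTraceClass S)
    (φ ψ φ' ψ' : ModeSpace n) :
    inner ℂ (tensor φ ψ) (partialTransposeB S (tensor φ' ψ')) =
      inner ℂ (tensor φ (star ψ')) (S (tensor φ' (star ψ))) := by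
  set e := basis (ModeSpace n)
  set B := adjoint (tensorLeft φ) ∘L S ∘L tensorLeft φ'
  have inner_B (f g : ModeSpace n) :
      inner ℂ (tensor φ f) (S (tensor φ' g)) = inner ℂ (adjoint B f) g := by
    rw [adjoint_inner_left, comp_apply, adjoint_inner_right, comp_apply]
    rfl
  have blocks := hS.hasSum_inner_tensor_partialTransposeB φ ψ φ' ψ'
  calc _ = ∑' j, ∑' k, inner ℂ (star ψ') (e j) *
        (inner ℂ (adjoint B (e j)) (e k) * inner ℂ (e k) (star ψ)) := by
        rw [← blocks.tsum_eq, blocks.summable.tsum_prod]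
        simp only [inner_B, e]
    _ = ∑' j, inner ℂ (star ψ') (e j) * inner ℂ (e j) (B (star ψ)) :=
        tsum_congr fun j => by rw [tsum_mul_left, e.tsum_inner_mul_inner, adjoint_inner_left]
    _ = inner ℂ (star ψ') (B (star ψ)) := e.tsum_inner_mul_inner _ _
    _ = _ := by rw [inner_B, adjoint_inner_left]

end Partial

/-! ### Weighted composition operators and displaced parities -/

section PhaseComp

variable {X Y Z : Type*} [MeasurableSpace X] [MeasurableSpace Y] [MeasurableSpace Z]
  {μ : Measure X} {ν : Measure Y} {τ : Measure Z}

/-- The weighted composition operator `f ↦ exp (i θ) • (f ∘ g)` on `L²`. Displacements, parities,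
linear changes of coordinates and all their products are of this form. -/
def phaseComp (θ : X → ℝ) (hθ : Measurable θ) (g : X → Y) (hg : MeasurePreserving g μ ν) :
    Lp ℂ 2 ν →ₗᵢ[ℂ] Lp ℂ 2 μ :=
  (phaseMul θ hθ).comp (Lp.compMeasurePreservingₗᵢ ℂ g hg)

theorem coeFn_phaseComp {θ : X → ℝ} (hθ : Measurable θ) {g : X → Y} (hg : MeasurePreserving g μ ν)
    (f : Lp ℂ 2 ν) : phaseComp θ hθ g hg f =ᵐ[μ] fun x => exp (θ x * I) * f (g x) := by
  filter_upwards [(memLp_phase_mul hθ (Lp.compMeasurePreservingₗᵢ ℂ g hg f)).coeFn_toLp,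
    Lp.coeFn_compMeasurePreserving f hg] with x h₁ h₂
  exact h₁.trans (congrArg _ h₂)

theorem phaseComp_zero {g : X → Y} (hg : MeasurePreserving g μ ν) :
    phaseComp 0 measurable_zero g hg = Lp.compMeasurePreservingₗᵢ ℂ g hg := by
  ext1 f
  refine Lp.ext ?_
  filter_upwards [coeFn_phaseComp measurable_zero hg f,
    Lp.coeFn_compMeasurePreserving f hg] with x h₁ h₂
  exact h₁.trans (by simpa using h₂.symm)

theorem phaseComp_zero_id (f : Lp ℂ 2 μ) :
    phaseComp 0 measurable_zero id (MeasurePreserving.id μ) f = f := by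
  refine Lp.ext ?_
  filter_upwards [coeFn_phaseComp measurable_zero (MeasurePreserving.id μ) f] with x h
  simpa using h

theorem phaseComp_phaseComp {θ : X → ℝ} (hθ : Measurable θ) {g : X → Y}
    (hg : MeasurePreserving g μ ν) {θ' : Y → ℝ} (hθ' : Measurable θ') {g' : Y → Z}
    (hg' : MeasurePreserving g' ν τ) (f : Lp ℂ 2 τ) :
    phaseComp θ hθ g hg (phaseComp θ' hθ' g' hg' f) =
      phaseComp (θ + θ' ∘ g) (hθ.add (hθ'.comp hg.measurable)) (g' ∘ g) (hg'.comp hg) f := by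
  refine Lp.ext ?_
  filter_upwards [coeFn_phaseComp hθ hg (phaseComp θ' hθ' g' hg' f),
    hg.quasiMeasurePreserving.ae (coeFn_phaseComp hθ' hg' f),
    coeFn_phaseComp (hθ.add (hθ'.comp hg.measurable)) (hg'.comp hg) f] with x h₁ h₂ h₃
  rw [h₁, h₂, h₃, ← mul_assoc, ← exp_add, ← add_mul, ← ofReal_add]
  rfl

theorem phaseComp_congr {θ θ' : X → ℝ} {hθ : Measurable θ} {hθ' : Measurable θ'} {g g' : X → Y}
    {hg : MeasurePreserving g μ ν} {hg' : MeasurePreserving g' μ ν} (h : ∀ x, θ x = θ' x)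
    (h' : ∀ x, g x = g' x) (f : Lp ℂ 2 ν) :
    phaseComp θ hθ g hg f = phaseComp θ' hθ' g' hg' f := by
  obtain rfl := funext h
  obtain rfl := funext h'
  rfl

theorem phaseComp_tensor {n : ℕ} {θ : Config n → ℝ} (hθ : Measurable θ) {g : Config n → Config n}
    (hg : MeasurePreserving g) (φ ψ : ModeSpace n) :
    phaseComp (θ ∘ Prod.fst) (hθ.comp measurable_fst) (Prod.map g id)
      (hg.prod (MeasurePreserving.id _)) (tensor φ ψ) = tensor (phaseComp θ hθ g hg φ) ψ := by
  have hgid := hg.prod (MeasurePreserving.id (volume : Measure (Config n)))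
  refine Lp.ext ?_
  filter_upwards [coeFn_phaseComp (hθ.comp measurable_fst) hgid (tensor φ ψ),
    hgid.quasiMeasurePreserving.ae (coeFn_tensor φ ψ), coeFn_tensor (phaseComp θ hθ g hg φ) ψ,
    Measure.quasiMeasurePreserving_fst.ae (coeFn_phaseComp hθ hg φ)] with z h₁ h₂ h₃ h₄
  rw [h₁, h₂, h₃, h₄, mul_assoc]
  rfl

end PhaseComp

section DisplacedParity

variable {n : ℕ}

theorem pos_neg (α : Fin n → ℂ) : pos (-α) = -pos α := by
  ext m
  simp [pos]

theorem mom_neg (α : Fin n → ℂ) : mom (-α) = -mom α := by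
  ext m
  simp [mom]

theorem pos_smul (c : ℝ) (α : Fin n → ℂ) : pos (c • α) = c • pos α := by
  ext m
  simp [pos, mul_left_comm]

theorem mom_smul (c : ℝ) (α : Fin n → ℂ) : mom (c • α) = c • mom α := by
  ext m
  simp [mom, mul_left_comm]

theorem displacement_apply (α : Fin n → ℂ) (f : ModeSpace n) :
    displacement α f =
      phaseComp (fun x => inner ℝ (mom α) x - inner ℝ (mom α) (pos α) / 2) (by fun_prop)
        (fun x => x - pos α) (measurePreserving_sub_right volume _) f := rfl

theorem parity_apply (f : ModeSpace n) :
    parity n f =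
      phaseComp 0 measurable_zero (fun x => -x) (Measure.measurePreserving_neg volume) f := by
  rw [phaseComp_zero]
  rfl

theorem adjoint_displacement (α : Fin n → ℂ) : adjoint (displacement α) = displacement (-α) := by
  refine adjoint_eq_of_apply_apply (fun f => ?_) fun f => ?_
  · rw [displacement_apply, LinearIsometry.norm_map]
  rw [displacement_apply, displacement_apply, phaseComp_phaseComp]
  refine (phaseComp_congr (fun x => ?_) (fun x => ?_) f).trans (phaseComp_zero_id f)
  · simp only [Pi.add_apply, Function.comp_apply, Pi.zero_apply, mom_neg, pos_neg, inner_neg_left,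
      inner_neg_right, inner_sub_right]
    ring
  · simp only [Function.comp_apply, pos_neg, sub_neg_eq_add, sub_add_cancel, id]

/-- The displaced parity operator `D(α) Π D(α)†`, whose expectation value is, up to normalization,
the Wigner function. -/
def displacedParity (α : Fin n → ℂ) : ModeSpace n →L[ℂ] ModeSpace n :=
  displacement α ∘L parity n ∘L adjoint (displacement α)

theorem displacedParity_apply (α : Fin n → ℂ) (f : ModeSpace n) :
    displacedParity α f =
      phaseComp (fun x => 2 * inner ℝ (mom α) (x - pos α)) (by fun_prop)
        (fun x => (2 : ℝ) • pos α - x) (Measure.measurePreserving_sub_left volume _) f := by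
  rw [displacedParity, adjoint_displacement, comp_apply, comp_apply, displacement_apply,
    displacement_apply, parity_apply, phaseComp_phaseComp, phaseComp_phaseComp]
  refine phaseComp_congr (fun x => ?_) (fun x => ?_) f
  · simp only [Pi.add_apply, Function.comp_apply, Pi.zero_apply, mom_neg, pos_neg, inner_neg_left,
      inner_neg_right, inner_sub_right]
    ring
  · simp only [Function.comp_apply, pos_neg]
    module

/-- The operator `D(α) Π D(α)† ⊗ 1`. -/
def displacedParityFst (α : Fin n → ℂ) : BipartiteSpace n →L[ℂ] BipartiteSpace n :=
  (phaseComp ((fun x : Config n => 2 * inner ℝ (mom α) (x - pos α)) ∘ Prod.fst) (by fun_prop)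
    (Prod.map (fun x : Config n => (2 : ℝ) • pos α - x) id)
    ((Measure.measurePreserving_sub_left volume _).prod (.id _))).toContinuousLinearMap

theorem displacedParityFst_tensor (α : Fin n → ℂ) (φ ψ : ModeSpace n) :
    displacedParityFst α (tensor φ ψ) = tensor (displacedParity α φ) ψ := by
  rw [displacedParity_apply, ← phaseComp_tensor]
  rfl

theorem adjoint_displacedParityFst (α : Fin n → ℂ) :
    adjoint (displacedParityFst α) = displacedParityFst α := by
  refine adjoint_eq_of_apply_apply (LinearIsometry.norm_map _) fun f => ?_
  refine (phaseComp_phaseComp _ _ _ _ f).trans <|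
    (phaseComp_congr (fun z => ?_) (fun z => ?_) f).trans (phaseComp_zero_id f)
  · simp only [Pi.add_apply, Function.comp_apply, Pi.zero_apply, Prod.map_fst, inner_sub_right,
      inner_smul_right]
    ring
  · simp only [Function.comp_apply, Prod.map_apply', id, sub_sub_cancel]

/-- The operator exchanging the two tensor factors. -/
def swap (n : ℕ) : BipartiteSpace n →L[ℂ] BipartiteSpace n :=
  (phaseComp 0 measurable_zero Prod.swap Measure.measurePreserving_swap).toContinuousLinearMap

theorem swap_tensor (φ ψ : ModeSpace n) : swap n (tensor φ ψ) = tensor ψ φ := by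
  have hswap := Measure.measurePreserving_swap (μ := (volume : Measure (Config n)))
    (ν := (volume : Measure (Config n)))
  refine Lp.ext ?_
  filter_upwards [coeFn_phaseComp measurable_zero hswap (tensor φ ψ),
    hswap.quasiMeasurePreserving.ae (coeFn_tensor φ ψ), coeFn_tensor ψ φ] with z h₁ h₂ h₃
  rw [h₃]
  refine h₁.trans ?_
  rw [h₂]
  simp [mul_comm]

theorem collectiveUnitary_apply (f : BipartiteSpace n) :
    collectiveUnitary n f =
      phaseComp 0 measurable_zero (collective n) (measurePreserving_collective n) f := by
  rw [phaseComp_zero]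
  rfl

theorem adjoint_collectiveUnitary : adjoint (collectiveUnitary n) = collectiveUnitary n := by
  refine adjoint_eq_of_apply_apply (LinearIsometry.norm_map _) fun f => ?_
  rw [collectiveUnitary_apply, collectiveUnitary_apply, phaseComp_phaseComp]
  refine (phaseComp_congr (fun z => ?_) (fun z => ?_) f).trans (phaseComp_zero_id f)
  · simp
  · exact DFunLike.congr_fun (collective_comp_self n) z

theorem collective_apply (z : Config n × Config n) :
    collective n z = ((√2)⁻¹ • (z.1 + z.2), (√2)⁻¹ • (z.1 - z.2)) := rfl

theorem collectiveUnitary_comp_displacedParityFst_comp (α : Fin n → ℂ) :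
    collectiveUnitary n ∘L displacedParityFst α ∘L collectiveUnitary n =
      displacedParityFst ((√2)⁻¹ • α) ∘L swap n ∘L displacedParityFst ((√2)⁻¹ • α) := by
  have half : (√2)⁻¹ * (√2)⁻¹ = (2 : ℝ)⁻¹ := by
    rw [← mul_inv, Real.mul_self_sqrt zero_le_two]
  ext1 f
  simp only [comp_apply, collectiveUnitary_apply, displacedParityFst, swap,
    LinearIsometry.coe_toContinuousLinearMap, phaseComp_phaseComp]
  refine phaseComp_congr (fun z => ?_) (fun z => ?_) f
  · simp only [Pi.add_apply, Function.comp_apply, Pi.zero_apply, collective_apply, Prod.fst_swap,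
      Prod.map_snd, mom_smul, pos_smul, inner_sub_right, inner_smul_left, inner_smul_right,
      conj_trivial, inner_add_right, id]
    linear_combination 4 * inner ℝ (mom α) (pos α) * half
  · ext1
    · simp only [Function.comp_apply, collective_apply, Prod.map_fst, Prod.map_snd, Prod.fst_swap,
        pos_smul, id, smul_add, smul_sub, smul_smul, half]
      module
    · simp only [Function.comp_apply, collective_apply, Prod.map_fst, Prod.map_snd, Prod.snd_swap,
        pos_smul, id, smul_add, smul_sub, smul_smul, half]
      module

end DisplacedParity

section Main

variable {n : ℕ} {ρ : BipartiteSpace n →L[ℂ] BipartiteSpace n}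

theorem IsTraceClass.trace_traceMinus_comp_displacedParity (hρ : IsTraceClass ρ) (α : Fin n → ℂ) :
    trace (traceMinus ρ ∘L displacedParity α) =
      trace (displacedParityFst ((√2)⁻¹ • α) ∘L ρ ∘L
        displacedParityFst ((√2)⁻¹ • α) ∘L swap n) := by
  have hUρ : IsTraceClass (ρ ∘L collectiveUnitary n) := hρ.comp _
  have hρA : IsTraceClass (ρ ∘L displacedParityFst ((√2)⁻¹ • α) ∘L swap n) := hρ.comp _
  calc trace (traceMinus ρ ∘L displacedParity α)
      = trace ((collectiveUnitary n ∘L ρ ∘L collectiveUnitary n) ∘L displacedParityFst α) := by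
        rw [traceMinus, adjoint_collectiveUnitary]
        exact (hUρ.comp_left _).trace_partialTraceSnd_comp (displacedParityFst_tensor α)
    _ = trace (collectiveUnitary n ∘L (ρ ∘L collectiveUnitary n ∘L displacedParityFst α)) := rfl
    _ = trace ((ρ ∘L collectiveUnitary n ∘L displacedParityFst α) ∘L collectiveUnitary n) :=
        ((hρ.comp _).trace_comp_comm _).symm
    _ = trace (ρ ∘L (collectiveUnitary n ∘L displacedParityFst α ∘L collectiveUnitary n)) := rfl
    _ = trace ((ρ ∘L displacedParityFst ((√2)⁻¹ • α) ∘L swap n) ∘L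
          displacedParityFst ((√2)⁻¹ • α)) := by
        rw [collectiveUnitary_comp_displacedParityFst_comp]
        rfl
    _ = _ := hρA.trace_comp_comm _

theorem IsTraceClass.inner_tensor_displacedParityFst_comp_swap (hρ : IsTraceClass ρ)
    (α : Fin n → ℂ) (φ ψ : ModeSpace n) :
    inner ℂ (tensor φ ψ)
        ((displacedParityFst α ∘L ρ ∘L displacedParityFst α ∘L swap n) (tensor φ ψ)) =
      inner ℂ (tensor (displacedParity α φ) (star φ))
        (partialTransposeB ρ (tensor (displacedParity α ψ) (star ψ))) := by
  rw [hρ.inner_tensor_partialTransposeB, star_star, star_star, comp_apply, comp_apply, comp_apply,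
    swap_tensor, displacedParityFst_tensor, ← adjoint_inner_left, adjoint_displacedParityFst,
    displacedParityFst_tensor]

theorem IsTraceClass.wigner_traceMinus_nonneg (hρ : IsTraceClass ρ)
    (hT : (partialTransposeB ρ).IsPositive) (α : Fin n → ℂ) : 0 ≤ wigner (traceMinus ρ) α := by
  refine mul_nonneg (pow_nonneg (Complex.zero_le_real.2 (by positivity)) n) ?_
  change 0 ≤ trace (traceMinus ρ ∘L displacedParity α)
  rw [hρ.trace_traceMinus_comp_displacedParity]
  have e := basis (ModeSpace n)
  have hsum := ((hρ.comp (displacedParityFst ((√2)⁻¹ • α) ∘L swap n)).comp_left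
    (displacedParityFst ((√2)⁻¹ • α))).hasSum_trace (tensorBasis e e)
  simp only [tensorBasis_apply] at hsum
  exact nonneg_of_hasSum_inner_apply
    (v := fun j => tensor (displacedParity ((√2)⁻¹ • α) (e j)) (star (e j))) hT
    (by simpa only [hρ.inner_tensor_displacedParityFst_comp_swap] using hsum)

end Main

end WignerPPT

end

theorem theorem2_general (n : ℕ)
    (ρ : WignerPPT.BipartiteSpace n →L[ℂ] WignerPPT.BipartiteSpace n)
    (hρ : WignerPPT.IsTraceClass ρ)
    (hneg : ¬ ∀ α : Fin n → ℂ, 0 ≤ WignerPPT.wigner (WignerPPT.traceMinus ρ) α) :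
    ¬ (WignerPPT.partialTransposeB ρ).IsPositive :=
  fun hT => hneg fun α => hρ.wigner_traceMinus_nonneg hT α

/-- Let `ρ` be a state of `2n` modes, split equally into `A` and `B`. If the Wigner function of the
reduced state `tr_- ρ` is not everywhere nonnegative, then the partial transpose `ρ^{T_B}` is not
positive semidefinite. -/
theorem theorem2 (n : ℕ)
    (ρ : WignerPPT.BipartiteSpace n →L[ℂ] WignerPPT.BipartiteSpace n)
    (hρ : WignerPPT.IsDensityOperator ρ)
    (hneg : ¬ ∀ α : Fin n → ℂ, 0 ≤ WignerPPT.wigner (WignerPPT.traceMinus ρ) α) :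
    ¬ (WignerPPT.partialTransposeB ρ).IsPositive :=
  theorem2_general n ρ
    (WignerPPT.isTraceClass_of_isPositive hρ.isPositive hρ.hasSum_trace.summable) hneg
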